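/- Let $\mathrm{Toff}_n$ be the $n$-qubit unitary with $\mathrm{Toff}_n|x\rangle|b\rangle=|x\rangle|b\oplus(x_1\wedge\dots\wedge x_{n-1})\rangle$ for $x\in\{0,1\}^{n-1}$, $b\in\{0,1\}$. A unitary Clifford+$T$ circuit $V$ on $n$ input qubits and any number $a$ of ancilla qubits is a finite sequence of gates, each either a Clifford gate (a unitary that conjugates Pauli operators to Pauli operators) or the gate $T=\mathrm{diag}(1,e^{i\pi/4})$ on one qubit. It defines the channel $\mathcal E_V(\rho)=\mathrm{Tr}_{\mathrm{anc}}[V(\rho\otimes|0^a\rangle\langle 0^a|)V^\dagger]$ on $n$ qubits. For channels $\mathcal E_1,\mathcal E_2$ on $n$ qubits let $D_\diamond(\mathcal E_1,\mathcal E_2)=\sup\tfrac12\|(\mathcal E_1\otimes I_\ell)(\rho)-(\mathcal E_2\otimes I_\ell)(\rho)\|_1$, the supremum being over $\ell\in\mathbb N$ and density matrices $\rho$ on $n+\ell$ qubits, where $I_\ell$ is the identity channel on $\ell$ qubits and $\|A\|_1=\mathrm{Tr}\sqrt{A^\dagger A}$. For an $n$-qubit unitary $U$ and $\epsilon\ge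 0$ let $\mathcal T^{\mathrm{unitary}}_\epsilon(U)$ be the minimum number of $T$ gates in a unitary Clifford+$T$ circuit $V$ such that $D_\diamond(\mathcal E_V,\Phi_U)\le\epsilon$, where $\Phi_U(\rho)=U\rho U^\dagger$. **Theorem.** For every $\epsilon\in[0,1/2)$ there is an $n_0$ such that for all $n\ge n_0$, $$\mathcal T^{\mathrm{unitary}}_\epsilon(\mathrm{Toff}_n)\ \ge\ n-2 .$$ -/

import Mathlib

open scoped Matrix Kronecker

namespace CliffordT

noncomputable section

/-! Quantum registers. Computational basis states of a register whose qubits are indexed by `ι`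
are bit strings `ι → Fin 2`; operators on the register are complex matrices indexed by them. -/

/-- Operators on the register with qubits `ι`. -/
abbrev Op (ι : Type) : Type := Matrix (ι → Fin 2) (ι → Fin 2) ℂ

/-- The tensor product `⨂ i, A i` of one-qubit operators. -/
def tensor {ι : Type} [Fintype ι] (A : ι → Matrix (Fin 2) (Fin 2) ℂ) : Op ι :=
  Matrix.of fun x y => ∏ i, A i (x i) (y i)

/-- The one-qubit operator `A` acting on qubit `j` (and the identity on all other qubits). -/
def onQubit {ι : Type} [Fintype ι] [DecidableEq ι] (j : ι) (A : Matrix (Fin 2) (Fin 2) ℂ) : Op ι :=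
  tensor (Function.update (fun _ => 1) j A)

/-- Pauli `X`. -/
def pauliX : Matrix (Fin 2) (Fin 2) ℂ := !![0, 1; 1, 0]

/-- Pauli `Y`. -/
def pauliY : Matrix (Fin 2) (Fin 2) ℂ := !![0, -Complex.I; Complex.I, 0]

/-- Pauli `Z`. -/
def pauliZ : Matrix (Fin 2) (Fin 2) ℂ := !![1, 0; 0, -1]

/-- The `T` gate `diag(1, e^{iπ/4})`. -/
def gateT : Matrix (Fin 2) (Fin 2) ℂ := !![1, 0; 0, Complex.exp (Complex.I * Real.pi / 4)]

/-- `P` is a signed Pauli operator, an element of `± {I, X, Y, Z}^{⊗ ι}`. -/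
def IsPauli {ι : Type} [Fintype ι] (P : Op ι) : Prop :=
  ∃ A : ι → Matrix (Fin 2) (Fin 2) ℂ,
    (∀ i, A i = 1 ∨ A i = pauliX ∨ A i = pauliY ∨ A i = pauliZ) ∧
      (P = tensor A ∨ P = -tensor A)

/-- `C` is a Clifford unitary: a unitary that conjugates Pauli operators to Pauli operators. -/
def IsClifford {ι : Type} [Fintype ι] [DecidableEq ι] (C : Op ι) : Prop :=
  C ∈ Matrix.unitaryGroup (ι → Fin 2) ℂ ∧ ∀ P : Op ι, IsPauli P → IsPauli (C * P * Cᴴ)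

/-- The gates of a unitary Clifford+T circuit on the qubits `ι`. A Clifford gate acting on some of
the qubits is, tensored with the identity on the others, a Clifford unitary of the register. -/
inductive Gate (ι : Type) [Fintype ι] [DecidableEq ι] : Type
  | clifford (C : Op ι) (hC : IsClifford C) : Gate ι
  | t (j : ι) : Gate ι

/-- The unitary of a gate. -/
def Gate.toOp {ι : Type} [Fintype ι] [DecidableEq ι] : Gate ι → Op ι
  | .clifford C _ => C
  | .t j => onQubit j gateT

/-- The number of `T` gates in a gate: `1` for a `T` gate and `0` for a Clifford gate. -/
def Gate.tCount {ι : Type} [Fintype ι] [DecidableEq ι] : Gate ι → ℕ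
  | .clifford _ _ => 0
  | .t _ => 1

/-- A unitary Clifford+T circuit: a finite sequence of gates, the head being applied first. -/
abbrev Circuit (ι : Type) [Fintype ι] [DecidableEq ι] : Type := List (Gate ι)

/-- The unitary implemented by a circuit. -/
def Circuit.toOp {ι : Type} [Fintype ι] [DecidableEq ι] : Circuit ι → Op ι
  | [] => 1
  | g :: c => Circuit.toOp c * g.toOp

/-- The number of `T` gates in a circuit. -/
def Circuit.tCount {ι : Type} [Fintype ι] [DecidableEq ι] : Circuit ι → ℕ
  | [] => 0
  | g :: c => g.tCount + Circuit.tCount c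

/-- The partial trace over the second tensor factor. -/
def partialTrace {α β : Type} [Fintype β] (M : Matrix (α × β) (α × β) ℂ) : Matrix α α ℂ :=
  Matrix.of fun x y => ∑ b, M (x, b) (y, b)

/-- The map `ρ ↦ U ρ U†`. -/
def unitaryChannel {α : Type} [Fintype α] (U : Matrix α α ℂ) : Matrix α α ℂ →ₗ[ℂ] Matrix α α ℂ where
  toFun ρ := U * ρ * Uᴴ
  map_add' ρ σ := by rw [mul_add, add_mul]
  map_smul' z ρ := by simp

/-- The projector `|0^a⟩⟨0^a|`. -/
def zeroState (a : ℕ) : Op (Fin a) := Matrix.single 0 0 1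

/-- An operator on `n + a` qubits, viewed on the tensor product of the `n`-qubit and the `a`-qubit
space. -/
def splitOp {n a : ℕ} (V : Op (Fin n ⊕ Fin a)) :
    Matrix ((Fin n → Fin 2) × (Fin a → Fin 2)) ((Fin n → Fin 2) × (Fin a → Fin 2)) ℂ :=
  Matrix.reindex (Equiv.sumArrowEquivProdArrow (Fin n) (Fin a) (Fin 2))
    (Equiv.sumArrowEquivProdArrow (Fin n) (Fin a) (Fin 2)) V

/-- The map `ρ ↦ Tr_anc [V (ρ ⊗ |0^a⟩⟨0^a|) V†]` on `n`-qubit operators. -/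
def ancillaChannel {n a : ℕ} (V : Op (Fin n ⊕ Fin a)) : Op (Fin n) →ₗ[ℂ] Op (Fin n) where
  toFun ρ := partialTrace (splitOp V * (ρ ⊗ₖ zeroState a) * (splitOp V)ᴴ)
  map_add' ρ σ := by
    ext x y
    simp [partialTrace, Matrix.add_kronecker, mul_add, add_mul, Finset.sum_add_distrib]
  map_smul' z ρ := by
    ext x y
    simp [partialTrace, Matrix.smul_kronecker, Finset.mul_sum]

open scoped ComplexOrder in
/-- `ρ` is a density matrix. -/
def IsDensity {α : Type} [Fintype α] (ρ : Matrix α α ℂ) : Prop :=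
  ρ.PosSemidef ∧ ρ.trace = 1

open scoped MatrixOrder in
/-- The trace norm `‖A‖₁ = Tr √(A† A)`. -/
def traceNorm {α : Type} [Fintype α] [DecidableEq α] (A : Matrix α α ℂ) : ℝ :=
  (CFC.sqrt (Aᴴ * A)).trace.re

/-- The trace distance `½ ‖ρ - σ‖₁`. -/
def traceDist {α : Type} [Fintype α] [DecidableEq α] (ρ σ : Matrix α α ℂ) : ℝ :=
  (1 / 2) * traceNorm (ρ - σ)

/-- `E ⊗ I`: the map `E` applied to the first tensor factor. -/
def ampliate {α : Type} (β : Type) (E : Matrix α α ℂ →ₗ[ℂ] Matrix α α ℂ)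
    (ρ : Matrix (α × β) (α × β) ℂ) : Matrix (α × β) (α × β) ℂ :=
  Matrix.of fun p q => E (Matrix.of fun x y => ρ (x, p.2) (y, q.2)) p.1 q.1

/-- The diamond distance: the supremum, over `ℓ` and over density matrices `ρ` on `n + ℓ` qubits,
of the trace distance of `(E₁ ⊗ I_ℓ)(ρ)` and `(E₂ ⊗ I_ℓ)(ρ)`. It is taken in the extended reals,
where every supremum exists. -/
def diamondDist {n : ℕ} (E₁ E₂ : Op (Fin n) →ₗ[ℂ] Op (Fin n)) : EReal :=
  ⨆ (ℓ : ℕ) (ρ : Matrix ((Fin n → Fin 2) × (Fin ℓ → Fin 2)) ((Fin n → Fin 2) × (Fin ℓ → Fin 2)) ℂ)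
    (_ : IsDensity ρ),
    ((traceDist (ampliate (Fin ℓ → Fin 2) E₁ ρ) (ampliate (Fin ℓ → Fin 2) E₂ ρ) : ℝ) : EReal)

/-- The `ε`-approximate unitary `T`-count of `U`: the minimum number of `T` gates in a unitary
Clifford+T circuit, with any number `a` of ancilla qubits, whose channel is within diamond distance
`ε` of `U` (and `⊤` if there were no such circuit). -/
def unitaryTCount {n : ℕ} (ε : ℝ) (U : Op (Fin n)) : ℕ∞ :=
  ⨅ (a : ℕ) (c : Circuit (Fin n ⊕ Fin a))
    (_ : diamondDist (ancillaChannel c.toOp) (unitaryChannel U) ≤ (ε : EReal)),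
    (c.tCount : ℕ∞)

/-- The action of the `n`-qubit Toffoli gate on bit strings: the last bit is flipped if and only if
all the other bits are `1`. -/
def toffoliMap (n : ℕ) (x : Fin n → Fin 2) : Fin n → Fin 2 := fun j =>
  if (j : ℕ) + 1 = n ∧ ∀ i : Fin n, (i : ℕ) + 1 < n → x i = 1 then x j + 1 else x j

/-- The `n`-qubit Toffoli gate. -/
def toffoli (n : ℕ) : Op (Fin n) :=
  Matrix.of fun y x => if y = toffoliMap n x then 1 else 0

end

end CliffordT

/-!
The lower bound follows from a covariance property of Clifford+`T` circuits with few `T` gates.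

A `T` gate on qubit `j` is a combination of `1` and the Pauli `Z` on `j`, so it commutes with every
operator commuting with that Pauli. Two Paulis either commute or anticommute, hence each `T` gate
sorts Paulis into two classes such that the product of two Paulis of one class passes through the
gate unchanged. A circuit with `t` `T` gates therefore sorts Paulis into at most `2 ^ t` classes such
that it conjugates the product of two Paulis of one class to a product of two Paulis
(`Circuit.exists_classes`). If `t < n - 2`, two distinct bit flips `X^v`, `X^w` supported on the
`n - 2` controls other than the first lie in one class by pigeonhole, and with `c = v + w ≠ 0` the
output distributions `q (· | x)` of the circuit on computational basis inputs satisfy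
`q (y | x + c) = q (y + p | x)` for a fixed bit string `p` (`Circuit.exists_outputProb_shift`).

The Toffoli map `f` has no such symmetry: `f (x + c) ≠ f x + p` for some `x`
(`toffoliMap_not_covariant`). Approximation within `ε` gives `q (f x | x) ≥ 1 - ε` for all `x`
(`one_sub_le_outputProb`), so the two distinct outcomes `f (x + c)` and `f x + p` both have
probability at least `1 - ε` on input `x + c`, which forces `ε ≥ 1 / 2`.
-/

open scoped Matrix Kronecker

namespace CliffordT

/-! ### The trace distance bounds differences of diagonal entries -/

open scoped MatrixOrder ComplexOrder in
/-- For Hermitian matrices of equal trace, the positive part of `B - A` has trace equal to the trace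
distance, and its diagonal entries are nonnegative and dominate those of `B - A`. -/
lemma re_sub_diag_le_traceDist {α : Type} [Fintype α] [DecidableEq α] {A B : Matrix α α ℂ}
    (hA : A.IsHermitian) (hB : B.IsHermitian) (htr : A.trace = B.trace) (i : α) :
    (B i i - A i i).re ≤ traceDist A B := by
  have hΔ : IsSelfAdjoint (A - B) := hA.sub hB
  set N : Matrix α α ℂ := CFC.abs (A - B) with hN
  have h1 : (N - (A - B)).PosSemidef := by
    have := CFC.abs_sub_self (A - B) hΔ
    rw [hN, this, ← Matrix.nonneg_iff_posSemidef]
    exact smul_nonneg (by norm_num) (CFC.negPart_nonneg _)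
  have h2 : (N + (A - B)).PosSemidef := by
    have := CFC.abs_add_self (A - B) hΔ
    rw [hN, this, ← Matrix.nonneg_iff_posSemidef]
    exact smul_nonneg (by norm_num) (CFC.posPart_nonneg _)
  have hT : traceNorm (A - B) = N.trace.re := rfl
  have hd2 : 0 ≤ (N i i + (A i i - B i i)).re := by
    simpa using (Complex.le_def.1 (h2.diag_nonneg (i := i))).1
  have hd1 : (N i i - (A i i - B i i)).re ≤ N.trace.re := by
    have h : (N - (A - B)).trace.re = N.trace.re := by simp [Matrix.trace_sub, htr]
    rw [← h, Matrix.trace, Complex.re_sum]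
    refine (Finset.single_le_sum (f := fun j => ((N - (A - B)).diag j).re) (fun j _ => ?_)
      (Finset.mem_univ i)).trans_eq' ?_
    · simpa using (Complex.le_def.1 (h1.diag_nonneg (i := j))).1
    · simp
  rw [traceDist, hT]
  simp only [Complex.add_re, Complex.sub_re] at *
  linarith

/-! ### Pauli operators -/

lemma add_self_fin_two {κ : Type} (p : κ → Fin 2) : p + p = 0 := by
  ext i
  simp only [Pi.add_apply, Pi.zero_apply]
  generalize p i = a
  fin_cases a <;> rfl

lemma eq_add_comm_fin_two {κ : Type} {x y p : κ → Fin 2} : y = x + p ↔ x = y + p := by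
  constructor <;> rintro rfl <;> rw [add_assoc, add_self_fin_two, add_zero]

section Pauli

variable {ι : Type} [Fintype ι]

lemma tensor_mul [DecidableEq ι] (A B : ι → Matrix (Fin 2) (Fin 2) ℂ) :
    tensor A * tensor B = tensor fun i => A i * B i := by
  ext x y
  simp only [tensor, Matrix.mul_apply, Matrix.of_apply, ← Finset.prod_mul_distrib]
  rw [Finset.prod_univ_sum, Fintype.piFinset_univ]

lemma tensor_one [DecidableEq ι] : tensor (fun _ : ι => 1) = 1 := by
  ext x y
  simp only [tensor, Matrix.of_apply, Matrix.one_apply, Finset.prod_ite_zero, funext_iff,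
    Finset.mem_univ, true_imp_iff, Finset.prod_const_one]

lemma tensor_conjTranspose (A : ι → Matrix (Fin 2) (Fin 2) ℂ) :
    (tensor A)ᴴ = tensor fun i => (A i)ᴴ := by
  ext x y
  simp [tensor, Matrix.conjTranspose_apply]

/-- A Pauli operator maps each basis state `x` to a phase times the basis state `x + p`. -/
lemma IsPauli.exists_shift {P : Op ι} (hP : IsPauli P) :
    ∃ p : ι → Fin 2, ∀ y x, ‖P y x‖ = if y = x + p then 1 else 0 := by
  obtain ⟨A, hA, h⟩ := hP
  have key : ∀ i, ∃ s : Fin 2, ∀ b a, ‖A i b a‖ = if b = a + s then 1 else 0 := by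
    intro i
    rcases hA i with h | h | h | h <;> rw [h]
    · exact ⟨0, by intro b a; fin_cases b <;> fin_cases a <;> simp⟩
    · exact ⟨1, by intro b a; fin_cases b <;> fin_cases a <;> simp [pauliX]⟩
    · exact ⟨1, by intro b a; fin_cases b <;> fin_cases a <;> simp [pauliY]⟩
    · exact ⟨0, by intro b a; fin_cases b <;> fin_cases a <;> simp [pauliZ]⟩
  choose p hp using key
  refine ⟨p, fun y x => ?_⟩
  have hn : ‖P y x‖ = ‖tensor A y x‖ := by rcases h with rfl | rfl <;> simp
  rw [hn]
  simp only [tensor, Matrix.of_apply, norm_prod, hp, Finset.prod_ite_zero, funext_iff,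
    Finset.mem_univ, true_imp_iff, Finset.prod_const_one, Pi.add_apply]

lemma norm_mul_of_shift [DecidableEq ι] {P : Op ι} {p : ι → Fin 2}
    (hp : ∀ y x, ‖P y x‖ = if y = x + p then 1 else 0) (M : Op ι) (y x : ι → Fin 2) :
    ‖(P * M) y x‖ = ‖M (y + p) x‖ := by
  rw [Matrix.mul_apply, Finset.sum_eq_single (y + p), norm_mul, hp, if_pos, one_mul]
  · rw [add_assoc, add_self_fin_two, add_zero]
  · intro z _ hz
    have : P y z = 0 := by
      rw [← norm_eq_zero, hp, if_neg]
      rwa [eq_add_comm_fin_two]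
    rw [this, zero_mul]
  · simp

/-- The bit flip `X^v = ⨂ i, X ^ (v i)`. -/
noncomputable def bitFlip (v : ι → Fin 2) : Op ι := tensor fun i => if v i = 0 then 1 else pauliX

lemma isPauli_bitFlip (v : ι → Fin 2) : IsPauli (bitFlip v) := by
  refine ⟨_, fun i => ?_, Or.inl rfl⟩
  by_cases h : v i = 0 <;> simp [h]

lemma bitFlip_apply [DecidableEq ι] (v y x : ι → Fin 2) :
    bitFlip v y x = if y = x + v then 1 else 0 := by
  have key : ∀ s b a : Fin 2, (if s = 0 then (1 : Matrix (Fin 2) (Fin 2) ℂ) else pauliX) b a =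
      if b = a + s then 1 else 0 := by
    intro s b a
    fin_cases s <;> fin_cases b <;> fin_cases a <;> simp [pauliX]
  simp only [bitFlip, tensor, Matrix.of_apply, key, Finset.prod_ite_zero, funext_iff,
    Finset.mem_univ, true_imp_iff, Finset.prod_const_one, Pi.add_apply]

lemma mul_bitFlip_apply [DecidableEq ι] (M : Op ι) (v y x : ι → Fin 2) :
    (M * bitFlip v) y x = M y (x + v) := by
  simp [Matrix.mul_apply, bitFlip_apply]

variable [DecidableEq ι]

lemma tensor_update_neg (A : ι → Matrix (Fin 2) (Fin 2) ℂ) (j : ι) (B : Matrix (Fin 2) (Fin 2) ℂ) :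
    tensor (Function.update A j (-B)) = -tensor (Function.update A j B) := by
  ext x y
  simp only [tensor, Matrix.of_apply, Matrix.neg_apply]
  rw [← Finset.mul_prod_erase _ _ (Finset.mem_univ j),
    ← Finset.mul_prod_erase Finset.univ (fun i => Function.update A j B i (x i) (y i))
      (Finset.mem_univ j), ← neg_mul]
  congr 1
  · simp
  · refine Finset.prod_congr rfl fun i hi => ?_
    simp [Function.update_of_ne (Finset.ne_of_mem_erase hi)]

lemma tensor_mul_onQubit (A : ι → Matrix (Fin 2) (Fin 2) ℂ) (j : ι)
    (B : Matrix (Fin 2) (Fin 2) ℂ) :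
    tensor A * onQubit j B = tensor (Function.update A j (A j * B)) := by
  rw [onQubit, tensor_mul]
  congr 1
  ext1 i
  rcases eq_or_ne i j with rfl | h <;> simp [*]

lemma onQubit_mul_tensor (A : ι → Matrix (Fin 2) (Fin 2) ℂ) (j : ι)
    (B : Matrix (Fin 2) (Fin 2) ℂ) :
    onQubit j B * tensor A = tensor (Function.update A j (B * A j)) := by
  rw [onQubit, tensor_mul]
  congr 1
  ext1 i
  rcases eq_or_ne i j with rfl | h <;> simp [*]

lemma IsPauli.commute_or_anticommute {P : Op ι} (hP : IsPauli P) (j : ι) :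
    P * onQubit j pauliZ = onQubit j pauliZ * P ∨
      P * onQubit j pauliZ = -(onQubit j pauliZ * P) := by
  obtain ⟨A, hA, h⟩ := hP
  have key : A j * pauliZ = pauliZ * A j ∨ A j * pauliZ = -(pauliZ * A j) := by
    rcases hA j with h | h | h | h <;> rw [h]
    · left; simp
    · right; simp [pauliX, pauliZ]
    · right; simp [pauliY, pauliZ]
    · left; rfl
  have key' : tensor A * onQubit j pauliZ = onQubit j pauliZ * tensor A ∨
      tensor A * onQubit j pauliZ = -(onQubit j pauliZ * tensor A) := by
    rw [tensor_mul_onQubit, onQubit_mul_tensor]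
    rcases key with h | h
    · left; rw [h]
    · right; rw [h, tensor_update_neg]
  rcases h with rfl | rfl
  · exact key'
  · simpa [neg_mul, mul_neg, neg_eq_iff_eq_neg] using key'

/-! ### Clifford+`T` circuits acting on Pauli operators -/

lemma onQubit_gateT_eq (j : ι) : ∃ α β : ℂ,
    onQubit j gateT = α • (1 : Op ι) + β • onQubit j pauliZ := by
  set w := Complex.exp (Complex.I * Real.pi / 4) with hw
  refine ⟨(1 + w) / 2, (1 - w) / 2, ?_⟩
  rw [← tensor_one]
  ext x y
  simp only [onQubit, tensor, Matrix.of_apply, Matrix.add_apply, Matrix.smul_apply, smul_eq_mul]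
  rw [← Finset.mul_prod_erase _ _ (Finset.mem_univ j),
    ← Finset.mul_prod_erase Finset.univ (fun i => (1 : Matrix (Fin 2) (Fin 2) ℂ) (x i) (y i))
      (Finset.mem_univ j),
    ← Finset.mul_prod_erase Finset.univ
      (fun i => Function.update (fun _ => (1 : Matrix (Fin 2) (Fin 2) ℂ)) j pauliZ i (x i) (y i))
      (Finset.mem_univ j)]
  have hrest : ∀ B : Matrix (Fin 2) (Fin 2) ℂ,
      ∏ i ∈ Finset.univ.erase j,
        Function.update (fun _ => (1 : Matrix (Fin 2) (Fin 2) ℂ)) j B i (x i) (y i) =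
      ∏ i ∈ Finset.univ.erase j, (1 : Matrix (Fin 2) (Fin 2) ℂ) (x i) (y i) := fun B =>
    Finset.prod_congr rfl fun i hi => by rw [Function.update_of_ne (Finset.ne_of_mem_erase hi)]
  rw [hrest, hrest, ← mul_assoc, ← mul_assoc, ← add_mul]
  congr 1
  simp only [Function.update_self]
  generalize x j = b
  generalize y j = d
  fin_cases b <;> fin_cases d <;> simp [gateT, pauliZ, ← hw] <;> ring

lemma onQubit_gateT_mul_conjTranspose (j : ι) :
    onQubit j gateT * (onQubit j gateT)ᴴ = 1 := by
  have hT : gateT * gateTᴴ = 1 := by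
    have : Complex.exp (Complex.I * Real.pi / 4) *
        (starRingEnd ℂ) (Complex.exp (Complex.I * Real.pi / 4)) = 1 := by
      rw [Complex.mul_conj, Complex.normSq_eq_norm_sq, Complex.norm_exp]
      simp
    ext b d
    fin_cases b <;> fin_cases d <;>
      simp [gateT, Matrix.mul_apply, Matrix.conjTranspose_apply, this]
  rw [onQubit, tensor_conjTranspose, tensor_mul, ← tensor_one]
  congr 1
  ext1 i
  rcases eq_or_ne i j with rfl | h <;> simp [*]

lemma Gate.toOp_mem_unitaryGroup (g : Gate ι) : g.toOp ∈ Matrix.unitaryGroup (ι → Fin 2) ℂ := by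
  cases g with
  | clifford C hC => exact hC.1
  | t j => exact Matrix.mem_unitaryGroup_iff.2 (onQubit_gateT_mul_conjTranspose j)

lemma Circuit.toOp_mem_unitaryGroup (c : Circuit ι) :
    c.toOp ∈ Matrix.unitaryGroup (ι → Fin 2) ℂ := by
  induction c with
  | nil => exact one_mem _
  | cons g c ih => exact mul_mem ih g.toOp_mem_unitaryGroup

/-- Two Paulis that behave alike with respect to `Z` on qubit `j` have a product commuting with the
`T` gate on `j`. -/
lemma conj_onQubit_gateT {P Q : Op ι} (hP : IsPauli P) (hQ : IsPauli Q) (j : ι)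
    (h : P * onQubit j pauliZ = onQubit j pauliZ * P ↔
      Q * onQubit j pauliZ = onQubit j pauliZ * Q) :
    onQubit j gateT * (P * Q) * (onQubit j gateT)ᴴ = P * Q := by
  have hZ : onQubit j pauliZ * (P * Q) = P * Q * onQubit j pauliZ := by
    by_cases hc : P * onQubit j pauliZ = onQubit j pauliZ * P
    · rw [mul_assoc, h.1 hc, ← mul_assoc, ← mul_assoc, hc]
    · have h1 := (hP.commute_or_anticommute j).resolve_left hc
      have h2 := (hQ.commute_or_anticommute j).resolve_left (mt h.2 hc)
      rw [mul_assoc P, h2, mul_neg, ← mul_assoc P, h1, neg_mul, neg_neg, mul_assoc]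
  obtain ⟨α, β, hT⟩ := onQubit_gateT_eq j
  have hcomm : onQubit j gateT * (P * Q) = P * Q * onQubit j gateT := by
    rw [hT, add_mul, mul_add, smul_mul_assoc, smul_mul_assoc, mul_smul_comm, mul_smul_comm, hZ,
      one_mul, mul_one]
  rw [hcomm, mul_assoc, onQubit_gateT_mul_conjTranspose, mul_one]

/-- A circuit with `t` `T` gates sorts Paulis into `2 ^ t` classes, such that it conjugates the
product of two Paulis of the same class to a product of two Paulis. Products of two Paulis are used
because they are closed under conjugation by Cliffords, and they absorb the phases `± i`, which
`IsPauli` excludes. -/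
lemma Circuit.exists_classes (c : Circuit ι) :
    ∃ f : Op ι → (Fin c.tCount → Bool), ∀ P Q, IsPauli P → IsPauli Q → f P = f Q →
      ∃ R S, IsPauli R ∧ IsPauli S ∧ c.toOp * (P * Q) * (c.toOp)ᴴ = R * S := by
  classical
  induction c with
  | nil => exact ⟨fun _ _ => false, fun P Q hP hQ _ => ⟨P, Q, hP, hQ, by simp [Circuit.toOp]⟩⟩
  | cons g c ih =>
    obtain ⟨f, hf⟩ := ih
    cases g with
    | clifford C hC =>
      have hcount : Circuit.tCount (Gate.clifford C hC :: c) = Circuit.tCount c := by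
        simp [Circuit.tCount, Gate.tCount]
      rw [hcount]
      refine ⟨fun P => f (C * P * Cᴴ), fun P Q hP hQ h => ?_⟩
      obtain ⟨R, S, hR, hS, hRS⟩ := hf _ _ (hC.2 P hP) (hC.2 Q hQ) h
      refine ⟨R, S, hR, hS, ?_⟩
      have hCC : Cᴴ * C = 1 := Matrix.mem_unitaryGroup_iff'.1 hC.1
      have hconj : C * P * Cᴴ * (C * Q * Cᴴ) = C * (P * Q) * Cᴴ := by
        calc C * P * Cᴴ * (C * Q * Cᴴ) = C * P * (Cᴴ * C) * Q * Cᴴ := by simp only [mul_assoc]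
          _ = C * (P * Q) * Cᴴ := by rw [hCC, mul_one, mul_assoc C P Q]
      rw [← hRS, hconj]
      simp only [Circuit.toOp, Gate.toOp, Matrix.conjTranspose_mul, mul_assoc]
    | t j =>
      have hcount : Circuit.tCount (Gate.t j :: c) = Circuit.tCount c + 1 := by
        simp [Circuit.tCount, Gate.tCount, add_comm]
      rw [hcount]
      refine ⟨fun P => Fin.cons (decide (P * onQubit j pauliZ = onQubit j pauliZ * P)) (f P),
        fun P Q hP hQ h => ?_⟩
      obtain ⟨h0, h1⟩ := Fin.cons_injective2 h
      obtain ⟨R, S, hR, hS, hRS⟩ := hf P Q hP hQ h1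
      refine ⟨R, S, hR, hS, ?_⟩
      rw [← hRS]
      nth_rw 2 [← conj_onQubit_gateT hP hQ j (decide_eq_decide.1 h0)]
      simp only [Circuit.toOp, Gate.toOp, Matrix.conjTranspose_mul, mul_assoc]

end Pauli

/-! ### Output distributions on computational basis inputs -/

section Output

variable {n a : ℕ}

/-- The probability that measuring the first `n` qubits of `V |x, 0^a⟩` in the computational basis
gives `y`. -/
noncomputable def outputProb (V : Op (Fin n ⊕ Fin a)) (x y : Fin n → Fin 2) : ℝ :=
  ∑ b : Fin a → Fin 2, ‖V (Sum.elim y b) (Sum.elim x 0)‖ ^ 2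

lemma sum_outputProb {V : Op (Fin n ⊕ Fin a)}
    (hV : V ∈ Matrix.unitaryGroup (Fin n ⊕ Fin a → Fin 2) ℂ) (x : Fin n → Fin 2) :
    ∑ y, outputProb V x y = 1 := by
  have h := congrFun₂ (Matrix.mem_unitaryGroup_iff'.1 hV) (Sum.elim x 0) (Sum.elim x 0)
  simp only [Matrix.mul_apply, Matrix.star_apply, Matrix.one_apply_eq] at h
  have h' : ∑ z, ‖V z (Sum.elim x 0)‖ ^ 2 = 1 := by
    have hterm : ∀ z, star (V z (Sum.elim x 0)) * V z (Sum.elim x 0) =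
        ((‖V z (Sum.elim x 0)‖ ^ 2 : ℝ) : ℂ) := fun z => by
      rw [Complex.star_def, Complex.conj_mul', Complex.ofReal_pow]
    simp only [hterm] at h
    exact_mod_cast h
  rw [← h', ← (Equiv.sumArrowEquivProdArrow (Fin n) (Fin a) (Fin 2)).symm.sum_comp,
    Fintype.sum_prod_type]
  rfl

lemma outputProb_nonneg (V : Op (Fin n ⊕ Fin a)) (x y : Fin n → Fin 2) :
    0 ≤ outputProb V x y := Finset.sum_nonneg fun _ _ => sq_nonneg _

lemma ancillaChannel_single_diag (V : Op (Fin n ⊕ Fin a)) (x y : Fin n → Fin 2) :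
    ancillaChannel V (Matrix.single x x 1) y y = (outputProb V x y : ℂ) := by
  have hk : (Matrix.single x x (1 : ℂ)) ⊗ₖ zeroState a =
      Matrix.single (x, (0 : Fin a → Fin 2)) (x, (0 : Fin a → Fin 2)) 1 := by
    rw [zeroState, Matrix.single_kronecker_single, mul_one]
  simp only [ancillaChannel, LinearMap.coe_mk, AddHom.coe_mk, hk, partialTrace, Matrix.of_apply,
    outputProb, Complex.ofReal_sum]
  refine Finset.sum_congr rfl fun b _ => ?_
  rw [Matrix.mul_apply, Finset.sum_eq_single (x, (0 : Fin a → Fin 2))]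
  · rw [Matrix.mul_single_apply_same, mul_one, Matrix.conjTranspose_apply, Complex.star_def,
      Complex.mul_conj']
    simp only [splitOp, Matrix.reindex_apply, Matrix.submatrix_apply, Complex.ofReal_pow]
    rfl
  · intro z _ hz
    rw [Matrix.mul_single_apply_of_ne _ _ _ _ _ hz, zero_mul]
  · simp

lemma ancillaChannel_isHermitian (V : Op (Fin n ⊕ Fin a)) {ρ : Op (Fin n)} (hρ : ρ.IsHermitian) :
    (ancillaChannel V ρ).IsHermitian := by
  have hk : (ρ ⊗ₖ zeroState a).IsHermitian := by
    rw [Matrix.IsHermitian, Matrix.conjTranspose_kronecker, hρ.eq]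
    simp [zeroState]
  have h := Matrix.isHermitian_mul_mul_conjTranspose (splitOp V) hk
  ext y z
  simp only [ancillaChannel, LinearMap.coe_mk, AddHom.coe_mk, partialTrace, Matrix.of_apply,
    Matrix.conjTranspose_apply, star_sum]
  exact Finset.sum_congr rfl fun b _ => h.apply _ _

lemma unitaryChannel_toffoli_single (x : Fin n → Fin 2) :
    unitaryChannel (toffoli n) (Matrix.single x x 1) =
      Matrix.single (toffoliMap n x) (toffoliMap n x) 1 := by
  ext y z
  simp only [unitaryChannel, LinearMap.coe_mk, AddHom.coe_mk]
  rw [Matrix.mul_apply, Finset.sum_eq_single x]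
  · rw [Matrix.mul_single_apply_same, mul_one, Matrix.conjTranspose_apply, toffoli]
    simp only [Matrix.of_apply, Matrix.single_apply]
    by_cases h1 : y = toffoliMap n x <;> by_cases h2 : z = toffoliMap n x <;>
      simp [h1, h2, eq_comm]
  · intro w _ hw
    rw [Matrix.mul_single_apply_of_ne _ _ _ _ _ hw, zero_mul]
  · simp

open scoped ComplexOrder in
/-- A circuit approximating the Toffoli gate in diamond distance computes the Toffoli map with
probability at least `1 - ε` on every basis state. It suffices to test the diamond distance on basis
states without a reference system. -/
lemma one_sub_le_outputProb {V : Op (Fin n ⊕ Fin a)} {ε : ℝ}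
    (hV : V ∈ Matrix.unitaryGroup (Fin n ⊕ Fin a → Fin 2) ℂ)
    (h : diamondDist (ancillaChannel V) (unitaryChannel (toffoli n)) ≤ (ε : EReal))
    (x : Fin n → Fin 2) : 1 - ε ≤ outputProb V x (toffoliMap n x) := by
  set ρ : Matrix ((Fin n → Fin 2) × (Fin 0 → Fin 2)) ((Fin n → Fin 2) × (Fin 0 → Fin 2)) ℂ :=
    Matrix.single (x, 0) (x, 0) 1 with hρ
  have hdens : IsDensity ρ := by
    refine ⟨?_, by simp [hρ]⟩
    have : ρ = Matrix.vecMulVec (Pi.single (x, 0) 1) (star (Pi.single (x, 0) 1)) := by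
      rw [hρ, Matrix.single_eq_single_vecMulVec_single]
      congr 1
      ext z
      by_cases hz : z = (x, 0) <;> simp [Pi.single_apply, hz]
    rw [this]
    exact Matrix.posSemidef_vecMulVec_self_star _
  have hle : traceDist (ampliate (Fin 0 → Fin 2) (ancillaChannel V) ρ)
      (ampliate (Fin 0 → Fin 2) (unitaryChannel (toffoli n)) ρ) ≤ ε := by
    rw [← EReal.coe_le_coe_iff]
    refine le_trans ?_ h
    exact le_iSup_of_le 0 (le_iSup_of_le ρ (le_iSup_of_le hdens le_rfl))
  have hamp : ∀ E : Op (Fin n) →ₗ[ℂ] Op (Fin n), ampliate (Fin 0 → Fin 2) E ρ =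
      Matrix.of fun p q => E (Matrix.single x x 1) p.1 q.1 := by
    intro E
    ext p q
    simp only [ampliate, Matrix.of_apply]
    refine congrFun₂ (congrArg E ?_) p.1 q.1
    ext y z
    simp [hρ, Matrix.single_apply, Prod.ext_iff, eq_iff_true_of_subsingleton]
  have hherm : (Matrix.single x x (1 : ℂ)).IsHermitian := by
    rw [Matrix.IsHermitian, Matrix.conjTranspose_single, star_one]
  rw [hamp, hamp, unitaryChannel_toffoli_single] at hle
  have hdiag := re_sub_diag_le_traceDist
    (A := Matrix.of fun p q : (Fin n → Fin 2) × (Fin 0 → Fin 2) =>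
      ancillaChannel V (Matrix.single x x 1) p.1 q.1)
    (B := Matrix.of fun p q : (Fin n → Fin 2) × (Fin 0 → Fin 2) =>
      Matrix.single (toffoliMap n x) (toffoliMap n x) (1 : ℂ) p.1 q.1) ?_ ?_ ?_ (toffoliMap n x, 0)
  · have := hdiag.trans hle
    simp only [Matrix.of_apply, ancillaChannel_single_diag, Matrix.single_apply_same,
      Complex.sub_re, Complex.one_re, Complex.ofReal_re] at this
    linarith
  · exact (ancillaChannel_isHermitian V hherm).submatrix Prod.fst
  · refine Matrix.IsHermitian.submatrix (A := Matrix.single _ _ (1 : ℂ)) ?_ Prod.fst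
    rw [Matrix.IsHermitian, Matrix.conjTranspose_single, star_one]
  · simp only [Matrix.trace, Matrix.diag_apply, Matrix.of_apply, Fintype.sum_prod_type,
      ancillaChannel_single_diag, Finset.univ_unique, Finset.sum_singleton]
    rw [← Complex.ofReal_sum, sum_outputProb hV]
    simp [Matrix.single_apply]

/-- If the bit flips `v` and `w` are conjugated by `V` to Paulis whose product is again a product of
Paulis, flipping the input by `v + w` amounts to flipping the output by a fixed bit string. -/
lemma Circuit.exists_outputProb_shift (c : Circuit (Fin n ⊕ Fin a)) {v w : Fin n → Fin 2}
    {R S : Op (Fin n ⊕ Fin a)} (hR : IsPauli R) (hS : IsPauli S)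
    (h : c.toOp * (bitFlip (Sum.elim v 0) * bitFlip (Sum.elim w 0)) * (c.toOp)ᴴ = R * S) :
    ∃ p, ∀ x y, outputProb c.toOp (x + (v + w)) y = outputProb c.toOp x (y + p) := by
  obtain ⟨r, hr⟩ := hR.exists_shift
  obtain ⟨s, hs⟩ := hS.exists_shift
  set V := c.toOp
  have hVV : Vᴴ * V = 1 := Matrix.mem_unitaryGroup_iff'.1 c.toOp_mem_unitaryGroup
  have hcov : V * bitFlip (Sum.elim v 0) * bitFlip (Sum.elim w 0) = R * (S * V) := by
    rw [← mul_assoc R, ← h, mul_assoc _ Vᴴ, hVV, mul_one, mul_assoc]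
  refine ⟨(r + s) ∘ Sum.inl, fun x y => ?_⟩
  have hentry : ∀ z, ‖V z (Sum.elim (x + (v + w)) 0)‖ = ‖V (z + (r + s)) (Sum.elim x 0)‖ := by
    intro z
    rw [← add_assoc z, ← norm_mul_of_shift hs, ← norm_mul_of_shift hr, ← hcov, mul_bitFlip_apply,
      mul_bitFlip_apply]
    congr 2
    ext i
    rcases i with i | i
    · simp [add_assoc, add_comm (v i)]
    · simp
  simp only [outputProb, hentry]
  rw [← Equiv.sum_comp (Equiv.addRight ((r + s) ∘ Sum.inr))]
  refine Finset.sum_congr rfl fun b _ => ?_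
  congr 3
  ext i
  rcases i with i | i
  · simp
  · have := congrFun (add_self_fin_two ((r + s) ∘ Sum.inr)) i
    simp_all [add_assoc]

end Output

/-! ### The Toffoli map -/

/-- No nonzero flip `c` of controls other than the first is transformed by the Toffoli map into a
bit flip `p`: the input `0` forces `p = c`, while the all-ones input forces `p ≠ c`. -/
lemma toffoliMap_not_covariant {m : ℕ} {c : Fin (m + 2) → Fin 2} (hc : c ≠ 0) (h0 : c 0 = 0)
    (hlast : c (Fin.last (m + 1)) = 0) (p : Fin (m + 2) → Fin 2) :
    ∃ x, toffoliMap (m + 2) (x + c) ≠ toffoliMap (m + 2) x + p := by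
  by_contra! H
  have hid : ∀ x : Fin (m + 2) → Fin 2, (∃ i : Fin (m + 2), (i : ℕ) + 1 < m + 2 ∧ x i = 0) →
      toffoliMap (m + 2) x = x := by
    rintro x ⟨i, hi, hx⟩
    ext1 j
    rw [toffoliMap, if_neg]
    rintro ⟨-, h⟩
    have := h i hi
    rw [hx] at this
    exact zero_ne_one this
  have hp : p = c := by
    have := H 0
    rw [hid 0 ⟨0, by simp, rfl⟩, hid (0 + c) ⟨0, by simp, by simp [h0]⟩] at this
    simpa using this.symm
  obtain ⟨i, hi⟩ := Function.ne_iff.1 hc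
  have hi1 : c i = 1 := by
    have hi' : c i ≠ 0 := hi
    omega
  have hilast : i ≠ Fin.last (m + 1) := by rintro rfl; exact hi hlast
  have hval : (i : ℕ) + 1 < m + 2 := by
    have := Fin.val_lt_last hilast
    omega
  have h1 := congrFun (H 1) (Fin.last (m + 1))
  rw [hid (1 + c) ⟨i, hval, by simp [hi1]⟩, hp] at h1
  simp [toffoliMap, hlast] at h1

end CliffordT

open CliffordT in
theorem theorem2 (ε : ℝ) (hε₀ : 0 ≤ ε) (hε : ε < 1 / 2) :
    ∃ n₀ : ℕ, ∀ n : ℕ, n₀ ≤ n →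
      (n : ℕ∞) - 2 ≤ CliffordT.unitaryTCount ε (CliffordT.toffoli n) := by
  refine ⟨2, fun n hn => ?_⟩
  obtain ⟨m, rfl⟩ := Nat.exists_eq_add_of_le' hn
  refine le_iInf fun a => le_iInf fun c => le_iInf fun hd => ?_
  have hm : ((m + 2 : ℕ) : ℕ∞) - 2 = (m : ℕ∞) := by
    have : ((m + 2 : ℕ) : ℕ∞) - ((2 : ℕ) : ℕ∞) = ((m + 2 - 2 : ℕ) : ℕ∞) := by norm_cast
    simpa using this
  rw [hm, Nat.cast_le]
  by_contra! hlt
  obtain ⟨f, hf⟩ := Circuit.exists_classes c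
  -- Bit flips of the controls other than the first, padded by zeros at the first and last qubit.
  set g : (Fin m → Fin 2) → (Fin (m + 2) → Fin 2) :=
    fun u => Fin.cons (α := fun _ => Fin 2) 0 (Fin.snoc (α := fun _ => Fin 2) u 0) with hg
  obtain ⟨u, u', hne, huu⟩ := Fintype.exists_ne_map_eq_of_card_lt
    (fun u : Fin m → Fin 2 => f (bitFlip (Sum.elim (g u) 0))) (by
      simpa using Nat.pow_lt_pow_right (by norm_num : 1 < 2) hlt)
  have hginj : Function.Injective g := fun u u' h =>
    (Fin.snoc_injective2 (α := fun _ => Fin 2) (Fin.cons_injective2 (α := fun _ => Fin 2) h).2).1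
  obtain ⟨R, S, hR, hS, hRS⟩ := hf _ _ (isPauli_bitFlip _) (isPauli_bitFlip _) huu
  obtain ⟨p, hp⟩ := c.exists_outputProb_shift hR hS hRS
  have hsum : g u + g u' ≠ 0 := fun h => hne (hginj (by
    have := (eq_add_comm_fin_two (x := g u) (y := 0) (p := g u')).1 h.symm
    simpa using this))
  have hfirst : ∀ u, g u 0 = 0 := fun u => rfl
  have hlast : ∀ u, g u (Fin.last (m + 1)) = 0 := fun u => by
    rw [hg, ← Fin.succ_last]
    simp
  obtain ⟨x, hx⟩ := toffoliMap_not_covariant hsum (by simp [hfirst]) (by simp [hlast]) p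
  have hV := c.toOp_mem_unitaryGroup
  have h1 := one_sub_le_outputProb hV hd (x + (g u + g u'))
  have h2 : 1 - ε ≤ outputProb c.toOp (x + (g u + g u')) (toffoliMap (m + 2) x + p) := by
    rw [hp, add_assoc, add_self_fin_two, add_zero]
    exact one_sub_le_outputProb hV hd x
  have h3 := Finset.add_le_sum (f := fun y => outputProb c.toOp (x + (g u + g u')) y)
    (fun y _ => outputProb_nonneg _ _ y) (Finset.mem_univ _) (Finset.mem_univ _) hx
  rw [sum_outputProb hV] at h3
  linarith
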